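/- A perfect secret sharing scheme $\mathcal S$ for a finite simple graph $G=(V,E)$ consists of random variables $\xi$ (the secret) and $\xi_v$, $v\in V$ (the shares), each taking finitely many values, on a common probability space, with Shannon entropy $H(\xi)>0$, such that (i) if $vw\in E$, then $\xi_v$ and $\xi_w$ together determine $\xi$ (almost surely), and (ii) if $A\subseteq V$ is an independent set, then $\xi$ and $(\xi_v)_{v\in A}$ are statistically independent. The information ratio of $\mathcal S$ is $\max_{v\in V}H(\xi_v)/H(\xi)$, and the information ratio of $G$ is the infimum of the information ratios of all perfect secret sharing schemes for $G$. Let $M(n)$ be the largest information ratio of a graph on $n$ vertices. There is an explicit constant $c>0$, namely $c=4$ will do, such that for infinitely many $n$ $$0.5\cdot\log_2 n\;\le\; M(n)\;\le\; c\cdot\frac{n}{\log_2 n}.$$ More precisely, the upper bound holds for every $n\ge 2$, and the lower bound is witnessed by cubes: for every $d\ge 2$ the edge graph of the $d$-dimensional cube (vertices the $0$–$1$ sequences of length $d$, two adjacent when they differ in exactly one place), which has $n=2^d$ vertices, has information ratio at least $0.5\cdot\log_2 n$. -/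

import Mathlib

open MeasureTheory ProbabilityTheory

noncomputable section

/-- Shannon entropy (in bits) of a random variable with values in a finite set:
`H(X) = - ∑ x, P(X = x) log₂ P(X = x)`, with `0 log 0 = 0`. -/
def shannonEntropy {Ω : Type*} [MeasurableSpace Ω] (μ : Measure Ω)
    {S : Type*} [Fintype S] (X : Ω → S) : ℝ :=
  ∑ x : S, Real.negMulLog (μ.real (X ⁻¹' {x})) / Real.log 2

/-- A perfect secret sharing scheme for the graph `G`: a secret and one share for each vertex,
random variables with finite alphabets on a common probability space, such that the two shares at
the ends of an edge determine the secret (almost surely), while the shares of any independent set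
of vertices are jointly statistically independent of the secret. The secret is required to be
nontrivial (positive entropy), as the information ratio divides by its entropy. -/
structure PerfectSecretSharingScheme {V : Type*} (G : SimpleGraph V) where
  Ω : Type
  [measurableSpaceΩ : MeasurableSpace Ω]
  μ : Measure Ω
  [isProbabilityMeasure : IsProbabilityMeasure μ]
  Secret : Type
  [fintypeSecret : Fintype Secret]
  [measurableSpaceSecret : MeasurableSpace Secret]
  [discreteSecret : DiscreteMeasurableSpace Secret]
  Share : V → Type
  [fintypeShare : ∀ v, Fintype (Share v)]
  [measurableSpaceShare : ∀ v, MeasurableSpace (Share v)]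
  [discreteShare : ∀ v, DiscreteMeasurableSpace (Share v)]
  secret : Ω → Secret
  measurable_secret : Measurable secret
  share : ∀ v, Ω → Share v
  measurable_share : ∀ v, Measurable (share v)
  edge_determines : ∀ v w, G.Adj v w →
    ∃ decode : Share v → Share w → Secret, ∀ᵐ ω ∂μ, secret ω = decode (share v ω) (share w ω)
  indep_of_isIndepSet : ∀ A : Set V, G.IsIndepSet A →
    IndepFun secret (fun ω (v : A) => share v ω) μ
  entropy_secret_pos : 0 < shannonEntropy μ secret

attribute [instance] PerfectSecretSharingScheme.measurableSpaceΩ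
  PerfectSecretSharingScheme.isProbabilityMeasure
  PerfectSecretSharingScheme.fintypeSecret
  PerfectSecretSharingScheme.measurableSpaceSecret
  PerfectSecretSharingScheme.discreteSecret
  PerfectSecretSharingScheme.fintypeShare
  PerfectSecretSharingScheme.measurableSpaceShare
  PerfectSecretSharingScheme.discreteShare

/-- The (worst case) information ratio of a scheme: the maximum over the vertices `v` of
`H(ξ_v) / H(ξ)`. -/
def PerfectSecretSharingScheme.ratio {V : Type*} {G : SimpleGraph V}
    (𝒮 : PerfectSecretSharingScheme G) : ℝ :=
  ⨆ v : V, shannonEntropy 𝒮.μ (𝒮.share v) / shannonEntropy 𝒮.μ 𝒮.secret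

/-- The (worst case) information ratio of a graph: the infimum of the information ratios of all
perfect secret sharing schemes for it. -/
def informationRatio {V : Type*} (G : SimpleGraph V) : ℝ :=
  ⨅ 𝒮 : PerfectSecretSharingScheme G, 𝒮.ratio

/-- The largest information ratio of a graph on `n` vertices (a maximum over finitely many
graphs). -/
def largestInformationRatio (n : ℕ) : ℝ :=
  ⨆ G : SimpleGraph (Fin n), informationRatio G

/-- The edge graph of the `d`-dimensional cube: 0-1 sequences of length `d`, two of them adjacent
when they differ in exactly one place. -/
def cubeGraph (d : ℕ) : SimpleGraph (Fin d → Bool) where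
  Adj x y := hammingDist x y = 1
  symm := ⟨fun x y h => by rwa [hammingDist_comm]⟩
  loopless := ⟨fun x h => by simp at h⟩

end

/-! ### Shannon entropy of finite random variables. -/

section Entropy

variable {Ω : Type*} [MeasurableSpace Ω] {μ : Measure Ω}
  {S T U : Type*} [Fintype S] [Fintype T] [Fintype U]

/-! Lower bound. Let `f X` be the entropy of the joint shares of `X` divided by that of the secret.
Entropy is monotone and submodular, and so it remains after the secret is adjoined to the shares.
Adjoining it adds `1` to `f` on independent sets and nothing on the others, which yields the strict
inequalities of `IsSecretPolymatroid`. Nothing else about the scheme is used.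

For the cube, let `A` be a parity class, hence an independent set. Induction on the dimension
(`cube_sum_insert_le`) compares the sum of `f (A ∪ {x})` over `x ∉ A` with the sum of `f (A \ {x})`
over `x ∈ A`: the former exceeds the latter by at most the sum of all `f {x}` minus a multiple of
the number of vertices. When two facets are glued, every edge between them contributes a gain of `1`
(`facets_add_one_le`). Since each `f (A ∪ {x})` is at least `f A + 1`, the singletons have average
at least `d / 2`, and so does the largest share.

Upper bound. A cover of the edges by complete bipartite graphs gives a one-bit scheme in which a
vertex holds one bit for each member of the cover containing it. Cut the vertices into blocks of
size `k`. For each subset `S` of a block, join `S` to the vertices whose neighbours in that block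
are exactly `S`. A vertex lies in one right side per block and in at most `2 ^ (k - 1)` left sides;
`k` about half of `log₂ n` balances the two counts. -/

theorem shannonEntropy_nonneg [IsProbabilityMeasure μ] (X : Ω → S) : 0 ≤ shannonEntropy μ X :=
  Finset.sum_nonneg fun _ _ => div_nonneg
    (Real.negMulLog_nonneg measureReal_nonneg measureReal_le_one) (Real.log_nonneg (by norm_num))

/-- Adjoining an almost sure function of `Y` to `Y` does not change its entropy. -/
theorem shannonEntropy_prodMk_of_ae_eq {X : Ω → S} {Y : Ω → T} (g : T → S)
    (h : ∀ᵐ ω ∂μ, X ω = g (Y ω)) :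
    shannonEntropy μ (fun ω => (X ω, Y ω)) = shannonEntropy μ Y := by
  classical
  unfold shannonEntropy
  rw [Fintype.sum_prod_type_right]
  refine Finset.sum_congr rfl fun y _ => ?_
  rw [Finset.sum_eq_single (g y)]
  · congr 2
    refine measureReal_congr ?_
    filter_upwards [h] with ω hω
    refine propext ⟨fun h' => (Prod.ext_iff.1 h').2, fun h' => ?_⟩
    have h' : Y ω = y := h'
    exact Prod.ext (by simp [hω, h']) h'
  · intro x _ hx
    have : μ.real ((fun ω => (X ω, Y ω)) ⁻¹' {(x, y)}) = 0 := by
      rw [measureReal_def, measure_eq_zero_iff_ae_notMem.2, ENNReal.toReal_zero]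
      filter_upwards [h] with ω hω h'
      simp only [Set.mem_preimage, Set.mem_singleton_iff, Prod.mk.injEq] at h'
      exact hx (by rw [← h'.1, ← h'.2, hω])
    simp [this]
  · simp

variable [MeasurableSpace S] [MeasurableSingletonClass S]
  [MeasurableSpace T] [MeasurableSingletonClass T]
  [MeasurableSpace U] [MeasurableSingletonClass U]

theorem sum_measureReal_preimage_eq_one [IsProbabilityMeasure μ] {X : Ω → S} (hX : Measurable X) :
    ∑ x, μ.real (X ⁻¹' {x}) = 1 := by
  simpa using sum_measureReal_preimage_singleton (μ := μ) (f := X) Finset.univ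
    (fun y _ => hX (measurableSet_singleton y))

/-- The law of a component is the marginal of the joint law. -/
theorem measureReal_preimage_eq_sum_prodMk [IsFiniteMeasure μ] {R : Type*} [MeasurableSpace R]
    [MeasurableSingletonClass R] {X : Ω → R} {Y : Ω → T} (hX : Measurable X) (hY : Measurable Y)
    (x : R) :
    μ.real (X ⁻¹' {x}) = ∑ y : T, μ.real ((fun ω => (X ω, Y ω)) ⁻¹' {(x, y)}) := by
  rw [← measureReal_biUnion_finset]
  · congr 1
    ext ω
    simp
  · intro y _ y' _ hyy'
    refine Set.disjoint_left.2 fun ω h h' => hyy' ?_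
    simp only [Set.mem_preimage, Set.mem_singleton_iff, Prod.mk.injEq] at h h'
    exact h.2.symm.trans h'.2
  · intro y _
    exact (hX.prodMk hY) (measurableSet_singleton _)

theorem shannonEntropy_le_prodMk [IsFiniteMeasure μ] {X : Ω → S} {Y : Ω → T}
    (hX : Measurable X) (hY : Measurable Y) :
    shannonEntropy μ X ≤ shannonEntropy μ (fun ω => (X ω, Y ω)) := by
  unfold shannonEntropy
  rw [Fintype.sum_prod_type]
  refine Finset.sum_le_sum fun x _ => ?_
  rw [← Finset.sum_div]
  refine div_le_div_of_nonneg_right ?_ (Real.log_nonneg one_le_two)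
  have h := measureReal_preimage_eq_sum_prodMk (μ := μ) hX hY x
  set P := μ.real (X ⁻¹' {x})
  set p := fun y : T => μ.real ((fun ω => (X ω, Y ω)) ⁻¹' {(x, y)})
  have hp : ∀ y, 0 ≤ p y := fun _ => measureReal_nonneg
  change Real.negMulLog P ≤ ∑ y, Real.negMulLog (p y)
  have hP : P = ∑ y, p y := h
  calc Real.negMulLog P = ∑ y, p y * (- Real.log P) := by
        rw [← Finset.sum_mul, ← hP, Real.negMulLog]; ring
    _ ≤ ∑ y, Real.negMulLog (p y) := by
        refine Finset.sum_le_sum fun y _ => ?_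
        -- A joint probability is at most its marginal, so its logarithm is no larger; probability
        -- zero is separated because `Real.log 0 = 0` would break monotonicity.
        rw [Real.negMulLog, neg_mul, mul_neg, neg_le_neg_iff]
        rcases (hp y).eq_or_lt with h0 | h0
        · simp [← h0]
        · exact mul_le_mul_of_nonneg_left (Real.log_le_log h0
            (hP ▸ Finset.single_le_sum (fun y _ => hp y) (Finset.mem_univ y))) (hp y)

theorem shannonEntropy_le_of_ae_eq [IsFiniteMeasure μ] {X : Ω → S} {Y : Ω → T}
    (hX : Measurable X) (hY : Measurable Y) (g : T → S) (h : ∀ᵐ ω ∂μ, X ω = g (Y ω)) :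
    shannonEntropy μ X ≤ shannonEntropy μ Y :=
  (shannonEntropy_le_prodMk hX hY).trans_eq (shannonEntropy_prodMk_of_ae_eq g h)

theorem shannonEntropy_le_of_comp [IsFiniteMeasure μ] {X : Ω → S} {Y : Ω → T}
    (hX : Measurable X) (hY : Measurable Y) (g : T → S) (h : ∀ ω, X ω = g (Y ω)) :
    shannonEntropy μ X ≤ shannonEntropy μ Y :=
  shannonEntropy_le_of_ae_eq hX hY g (ae_of_all _ h)

theorem shannonEntropy_prodMk_of_indepFun [IsProbabilityMeasure μ] {X : Ω → S} {Y : Ω → T}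
    (hX : Measurable X) (hY : Measurable Y) (h : IndepFun X Y μ) :
    shannonEntropy μ (fun ω => (X ω, Y ω)) = shannonEntropy μ X + shannonEntropy μ Y := by
  have hjoint : ∀ x y, μ.real ((fun ω => (X ω, Y ω)) ⁻¹' {(x, y)})
      = μ.real (X ⁻¹' {x}) * μ.real (Y ⁻¹' {y}) := by
    intro x y
    have := h.measure_inter_preimage_eq_mul {x} {y}
      (measurableSet_singleton x) (measurableSet_singleton y)
    rw [measureReal_def, measureReal_def, measureReal_def, ← ENNReal.toReal_mul, ← this]
    congr 2
    ext ω
    simp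
  have hlhs : ∑ x, ∑ y, Real.negMulLog (μ.real (X ⁻¹' {x}) * μ.real (Y ⁻¹' {y})) =
      ∑ x, Real.negMulLog (μ.real (X ⁻¹' {x})) + ∑ y, Real.negMulLog (μ.real (Y ⁻¹' {y})) := by
    simp_rw [Real.negMulLog_mul, Finset.sum_add_distrib, ← Finset.sum_mul, ← Finset.mul_sum,
      ← Finset.sum_mul]
    rw [sum_measureReal_preimage_eq_one hX, sum_measureReal_preimage_eq_one hY]
    ring
  unfold shannonEntropy
  rw [Fintype.sum_prod_type]
  simp_rw [hjoint, ← Finset.sum_div]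
  rw [hlhs, add_div]

/-- Pointwise form of Gibbs' inequality. -/
theorem mul_log_ratio_le {p a b c : ℝ} (hp : 0 ≤ p) (ha : p ≤ a) (hb : p ≤ b) (hc : p ≤ c) :
    p * (Real.log a + Real.log b - Real.log p - Real.log c) ≤ a * b / c - p := by
  rcases hp.eq_or_lt with rfl | hp
  · have : 0 ≤ a * b / c := by positivity
    simpa using this
  · have ha := hp.trans_le ha
    have hb := hp.trans_le hb
    have hc := hp.trans_le hc
    have h1 : Real.log a + Real.log b - Real.log p - Real.log c
        = Real.log (a * b / (p * c)) := by
      rw [Real.log_div (by positivity) (by positivity), Real.log_mul ha.ne' hb.ne',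
        Real.log_mul hp.ne' hc.ne']
      ring
    rw [h1]
    calc _ ≤ p * (a * b / (p * c) - 1) := by
          gcongr
          exact Real.log_le_sub_one_of_pos (by positivity)
      _ = _ := by field_simp

/-- Conditional mutual information is nonnegative. -/
theorem shannonEntropy_submodular [IsFiniteMeasure μ] {X : Ω → S} {Y : Ω → T} {Z : Ω → U}
    (hX : Measurable X) (hY : Measurable Y) (hZ : Measurable Z) :
    shannonEntropy μ (fun ω => ((Z ω, X ω), Y ω)) + shannonEntropy μ Z
      ≤ shannonEntropy μ (fun ω => (Z ω, X ω)) + shannonEntropy μ (fun ω => (Z ω, Y ω)) := by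
  set p : U → S → T → ℝ := fun z x y => μ.real ((fun ω => ((Z ω, X ω), Y ω)) ⁻¹' {((z, x), y)})
  set a : U → S → ℝ := fun z x => μ.real ((fun ω => (Z ω, X ω)) ⁻¹' {(z, x)})
  set b : U → T → ℝ := fun z y => μ.real ((fun ω => (Z ω, Y ω)) ⁻¹' {(z, y)})
  set c : U → ℝ := fun z => μ.real (Z ⁻¹' {z})
  have hp : ∀ z x y, 0 ≤ p z x y := fun _ _ _ => measureReal_nonneg
  have ha : ∀ z x, 0 ≤ a z x := fun _ _ => measureReal_nonneg
  have hpa : ∀ z x, a z x = ∑ y, p z x y := fun z x =>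
    measureReal_preimage_eq_sum_prodMk (hZ.prodMk hX) hY (z, x)
  have hpb : ∀ z y, b z y = ∑ x, p z x y := by
    intro z y
    refine (measureReal_preimage_eq_sum_prodMk (hZ.prodMk hY) hX (z, y)).trans
      (Finset.sum_congr rfl fun x _ => ?_)
    change μ.real _ = μ.real _
    congr 1
    ext ω
    simp only [Set.mem_preimage, Set.mem_singleton_iff, Prod.mk.injEq]
    tauto
  have hac : ∀ z, c z = ∑ x, a z x := fun z => measureReal_preimage_eq_sum_prodMk hZ hX z
  have hbc : ∀ z, c z = ∑ y, b z y := fun z => measureReal_preimage_eq_sum_prodMk hZ hY z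
  have hple : ∀ z x y, p z x y ≤ a z x := fun z x y => by
    rw [hpa]; exact Finset.single_le_sum (fun y _ => hp z x y) (Finset.mem_univ y)
  have hple' : ∀ z x y, p z x y ≤ b z y := fun z x y => by
    rw [hpb]; exact Finset.single_le_sum (fun x _ => hp z x y) (Finset.mem_univ x)
  have hale : ∀ z x, a z x ≤ c z := fun z x => by
    rw [hac]; exact Finset.single_le_sum (fun x _ => ha z x) (Finset.mem_univ x)
  have key : ∀ z, ∑ x, ∑ y, p z x y * (Real.log (a z x) + Real.log (b z y) - Real.log (p z x y)
      - Real.log (c z)) ≤ 0 := by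
    intro z
    -- The bound sums to zero: `a * b / c` is the law that makes the other two variables
    -- conditionally independent given `z`, and it has the same mass `c z` as `p`.
    calc _ ≤ ∑ x, ∑ y, (a z x * b z y / c z - p z x y) :=
          Finset.sum_le_sum fun x _ => Finset.sum_le_sum fun y _ =>
            mul_log_ratio_le (hp z x y) (hple z x y) (hple' z x y) ((hple z x y).trans (hale z x))
      _ = c z * c z / c z - c z := by
          simp_rw [Finset.sum_sub_distrib, ← hpa, ← hac, ← Finset.sum_div, ← Finset.mul_sum,
            ← hbc, ← Finset.sum_mul, ← hac]
      _ = 0 := by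
          rcases eq_or_ne (c z) 0 with h | h
          · simp [h]
          · field_simp; ring
  have expand : ∀ z, ∑ x, ∑ y, p z x y * (Real.log (a z x) + Real.log (b z y)
      - Real.log (p z x y) - Real.log (c z)) =
      ∑ x, ∑ y, Real.negMulLog (p z x y) + Real.negMulLog (c z)
        - ∑ x, Real.negMulLog (a z x) - ∑ y, Real.negMulLog (b z y) := by
    intro z
    have h1 : ∑ x, Real.negMulLog (a z x) = - ∑ x, ∑ y, p z x y * Real.log (a z x) := by
      simp_rw [← Finset.sum_mul, ← hpa, Real.negMulLog, neg_mul, Finset.sum_neg_distrib]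
    have h2 : ∑ y, Real.negMulLog (b z y) = - ∑ x, ∑ y, p z x y * Real.log (b z y) := by
      rw [Finset.sum_comm]
      simp_rw [← Finset.sum_mul, ← hpb, Real.negMulLog, neg_mul, Finset.sum_neg_distrib]
    have h3 : Real.negMulLog (c z) = - ∑ x, ∑ y, p z x y * Real.log (c z) := by
      simp_rw [← Finset.sum_mul, ← hpa, ← hac, Real.negMulLog, neg_mul]
    have h4 : ∑ x, ∑ y, Real.negMulLog (p z x y) = - ∑ x, ∑ y, p z x y * Real.log (p z x y) := by
      simp_rw [Real.negMulLog, neg_mul, Finset.sum_neg_distrib]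
    rw [h1, h2, h3, h4]
    simp_rw [mul_sub, mul_add, Finset.sum_sub_distrib, Finset.sum_add_distrib]
    ring
  have total := Finset.sum_nonpos (fun z (_ : z ∈ Finset.univ) => key z)
  simp_rw [expand, Finset.sum_sub_distrib, Finset.sum_add_distrib] at total
  unfold shannonEntropy
  simp_rw [Fintype.sum_prod_type, ← Finset.sum_div, ← add_div]
  refine div_le_div_of_nonneg_right ?_ (Real.log_nonneg one_le_two)
  change ∑ z, ∑ x, ∑ y, Real.negMulLog (p z x y) + ∑ z, Real.negMulLog (c z) ≤
    ∑ z, ∑ x, Real.negMulLog (a z x) + ∑ z, ∑ y, Real.negMulLog (b z y)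
  linarith

/-- Entropy is at most the logarithm of the size of the alphabet. -/
theorem shannonEntropy_le_logb_card [IsProbabilityMeasure μ] {X : Ω → S} (hX : Measurable X) :
    shannonEntropy μ X ≤ Real.logb 2 (Fintype.card S) := by
  have hsum := sum_measureReal_preimage_eq_one (μ := μ) hX
  have hne : Nonempty S := by
    by_contra h
    rw [not_nonempty_iff] at h
    simp at hsum
  have hcard : (0 : ℝ) < Fintype.card S := by exact_mod_cast Fintype.card_pos
  unfold shannonEntropy
  rw [← Finset.sum_div, Real.logb]
  refine div_le_div_of_nonneg_right ?_ (Real.log_nonneg one_le_two)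
  -- Jensen with equal weights: the mean of the probabilities is the reciprocal of the alphabet
  -- size.
  have h := Real.concaveOn_negMulLog.le_map_sum (t := Finset.univ)
    (w := fun _ : S => (Fintype.card S : ℝ)⁻¹) (p := fun x => μ.real (X ⁻¹' {x}))
    (fun _ _ => by positivity) (by simp [hcard.ne']) (fun _ _ => measureReal_nonneg)
  simp only [smul_eq_mul, ← Finset.mul_sum, hsum, mul_one] at h
  rw [Real.negMulLog, Real.log_inv, neg_mul_neg] at h
  exact le_of_mul_le_mul_left h (by positivity)

end Entropy

/-! ### Polymatroids with the strict inequalities forced by a secret. -/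

/-- The properties of the normalized entropy `X ↦ H(ξ_X) / H(ξ)` of the shares of a perfect secret
sharing scheme: a monotone submodular function, with a gain of one when passing from an independent
set to a set containing an edge, and in the submodular inequality for two sets that contain edges
and meet in an independent set. -/
structure IsSecretPolymatroid {V : Type*} [DecidableEq V] (G : SimpleGraph V)
    (f : Finset V → ℝ) : Prop where
  empty_nonneg : 0 ≤ f ∅
  submodular : ∀ X Y, f (X ∪ Y) + f (X ∩ Y) ≤ f X + f Y
  mono : ∀ X Y : Finset V, X ⊆ Y → f X ≤ f Y
  strict_mono : ∀ X Y : Finset V, X ⊆ Y → G.IsIndepSet (X : Set V) → ¬ G.IsIndepSet (Y : Set V) →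
    f X + 1 ≤ f Y
  strict_submodular : ∀ X Y : Finset V, ¬ G.IsIndepSet (X : Set V) → ¬ G.IsIndepSet (Y : Set V) →
    G.IsIndepSet ((X ∩ Y : Finset V) : Set V) → f (X ∪ Y) + f (X ∩ Y) + 1 ≤ f X + f Y

namespace IsSecretPolymatroid

variable {V W : Type*} [DecidableEq V] [DecidableEq W] {G : SimpleGraph V} {H : SimpleGraph W}
  {f : Finset V → ℝ}

/-- An induced embedding both preserves and reflects independence. This restricts `f` to the facets
in the induction, and to a cube sitting inside a larger graph. -/
theorem comap (hf : IsSecretPolymatroid G f) (φ : H ↪g G) :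
    IsSecretPolymatroid H (fun X => f (X.map φ.toEmbedding)) := by
  have hindep : ∀ X : Finset W, G.IsIndepSet ((X.map φ.toEmbedding : Finset V) : Set V) ↔
      H.IsIndepSet (X : Set W) := by
    intro X
    simp only [SimpleGraph.isIndepSet_iff, Finset.coe_map]
    constructor
    · intro h x hx y hy hxy hadj
      exact h ⟨x, hx, rfl⟩ ⟨y, hy, rfl⟩ (φ.injective.ne hxy) (φ.map_adj_iff.2 hadj)
    · rintro h _ ⟨x, hx, rfl⟩ _ ⟨y, hy, rfl⟩ hxy hadj
      exact h hx hy (fun e => hxy (by rw [e])) (φ.map_adj_iff.1 hadj)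
  constructor
  · simpa using hf.empty_nonneg
  · intro X Y
    simpa only [Finset.map_union, Finset.map_inter] using hf.submodular _ _
  · intro X Y h
    exact hf.mono _ _ (Finset.map_subset_map.2 h)
  · intro X Y h hX hY
    exact hf.strict_mono _ _ (Finset.map_subset_map.2 h) ((hindep X).2 hX)
      (fun h' => hY ((hindep Y).1 h'))
  · intro X Y hX hY hXY
    have := hf.strict_submodular (X.map φ.toEmbedding) (Y.map φ.toEmbedding)
      (fun h' => hX ((hindep X).1 h')) (fun h' => hY ((hindep Y).1 h'))
      (by rw [← Finset.map_inter]; exact (hindep _).2 hXY)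
    simpa only [Finset.map_union, Finset.map_inter] using this

/-- The gain obtained from one edge `ab` when two sets `A ∋ a` and `A'` are merged. -/
theorem add_one_le_of_adj (hf : IsSecretPolymatroid G f) {A A' : Finset V} {a b : V}
    (hAA' : Disjoint A A') (ha : a ∈ A) (hbA : b ∉ A) (hbA' : b ∉ A') (hab : G.Adj a b)
    (hindep : G.IsIndepSet ((insert b (A.erase a) : Finset V) : Set V))
    (hdep : ¬ G.IsIndepSet ((insert b A' : Finset V) : Set V)) :
    f (insert b (A ∪ A')) + f (A.erase a) + f A' + 1
      ≤ f (insert b A') + f ((A ∪ A').erase a) + f A := by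
  have haA' : a ∉ A' := Finset.disjoint_left.1 hAA' ha
  have hdisj : ∀ x, x ∈ A → x ∉ A' := fun _ => (Finset.disjoint_left.1 hAA' ·)
  have hne : a ≠ b := hab.ne
  -- The unit comes from here: the first set contains the dependent `insert b A'`, the second
  -- contains the edge `ab`, and they meet in `insert b (A.erase a)`. The two plain inequalities
  -- that follow cancel the auxiliary terms.
  have h1 := hf.strict_submodular (insert b (A' ∪ A.erase a)) (insert b A)
    (fun h => hdep (h.mono (by
      intro x hx
      simp only [Finset.coe_insert, Set.mem_insert_iff, Finset.mem_coe, Finset.mem_union] at hx ⊢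
      tauto)))
    (fun h => h (by simp [ha]) (by simp) hne hab)
    (by
      refine hindep.mono ?_
      intro x hx
      simp only [Finset.coe_insert, Set.mem_insert_iff, Finset.mem_coe, Finset.mem_union,
        Finset.mem_inter, Finset.mem_insert] at hx ⊢
      have := hdisj x
      tauto)
  have h2 := hf.submodular A (insert b (A.erase a))
  have h3 := hf.submodular (insert b A') ((A ∪ A').erase a)
  have e1 : insert b (A' ∪ A.erase a) ∪ insert b A = insert b (A ∪ A') := by grind
  have e2 : insert b (A' ∪ A.erase a) ∩ insert b A = insert b (A.erase a) := by grind
  have e3 : A ∪ insert b (A.erase a) = insert b A := by grind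
  have e4 : A ∩ insert b (A.erase a) = A.erase a := by grind
  have e5 : insert b A' ∪ (A ∪ A').erase a = insert b (A' ∪ A.erase a) := by grind
  have e6 : insert b A' ∩ (A ∪ A').erase a = A' := by grind
  rw [e1, e2] at h1
  rw [e3, e4] at h2
  rw [e5, e6] at h3
  linarith

end IsSecretPolymatroid

/-! ### Parity classes and facets of the cube, and the inductive inequality. -/

section Cube

/-- The parity of the number of ones in a 0-1 sequence. -/
def cubeParity {d : ℕ} (x : Fin d → Bool) : ZMod 2 := ∑ i, if x i then 1 else 0

/-- The vertices of the cube of a given parity. -/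
def cubeParityClass (d : ℕ) (p : ZMod 2) : Finset (Fin d → Bool) :=
  Finset.univ.filter fun x => cubeParity x = p

theorem mem_cubeParityClass {d : ℕ} {p : ZMod 2} {x : Fin d → Bool} :
    x ∈ cubeParityClass d p ↔ cubeParity x = p := by
  simp [cubeParityClass]

theorem cubeParity_add_eq_hammingDist {d : ℕ} (x y : Fin d → Bool) :
    cubeParity x + cubeParity y = (hammingDist x y : ZMod 2) := by
  rw [hammingDist, Finset.card_filter, Nat.cast_sum, cubeParity, cubeParity,
    ← Finset.sum_add_distrib]
  refine Finset.sum_congr rfl fun i _ => ?_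
  cases x i <;> cases y i <;> decide

theorem hammingDist_cons {d : ℕ} (s t : Bool) (x y : Fin d → Bool) :
    hammingDist (Fin.cons s x : Fin (d + 1) → Bool) (Fin.cons t y : Fin (d + 1) → Bool)
      = (if s ≠ t then 1 else 0) + hammingDist x y := by
  simp only [hammingDist, Finset.card_filter, Fin.sum_univ_succ, Fin.cons_zero, Fin.cons_succ]

theorem cubeParity_cons {d : ℕ} (s : Bool) (x : Fin d → Bool) :
    cubeParity (Fin.cons s x : Fin (d + 1) → Bool) = (if s then 1 else 0) + cubeParity x := by
  simp only [cubeParity, Fin.sum_univ_succ, Fin.cons_zero, Fin.cons_succ]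

theorem cubeGraph_adj {d : ℕ} {x y : Fin d → Bool} :
    (cubeGraph d).Adj x y ↔ hammingDist x y = 1 := Iff.rfl

theorem cubeParity_eq_add_one_of_adj {d : ℕ} {x y : Fin d → Bool} (h : (cubeGraph d).Adj x y) :
    cubeParity y = cubeParity x + 1 := by
  have := cubeParity_add_eq_hammingDist x y
  rw [cubeGraph_adj.1 h] at this
  revert this
  generalize cubeParity x = p
  generalize cubeParity y = q
  revert p q
  decide

theorem isIndepSet_cubeParityClass (d : ℕ) (p : ZMod 2) :
    (cubeGraph d).IsIndepSet (cubeParityClass d p : Set (Fin d → Bool)) := by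
  intro x hx y hy _ h
  rw [Finset.mem_coe, mem_cubeParityClass] at hx hy
  have := cubeParity_eq_add_one_of_adj h
  rw [hx, hy] at this
  simp at this

/-- The facet embedding `x ↦ (s, x)` of the `d`-cube into the `(d + 1)`-cube. -/
def cubeFacet (d : ℕ) (s : Bool) : cubeGraph d ↪g cubeGraph (d + 1) where
  toFun x := Fin.cons s x
  inj' _ _ h := Fin.cons_right_injective (α := fun _ => Bool) s h
  map_rel_iff' := by
    intro x y
    change hammingDist (Fin.cons s x : Fin (d + 1) → Bool) (Fin.cons s y) = 1 ↔ hammingDist x y = 1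
    simp [hammingDist_cons]

theorem cubeFacet_apply {d : ℕ} (s : Bool) (x : Fin d → Bool) :
    cubeFacet d s x = Fin.cons s x := rfl

theorem cubeFacet_adj_cubeFacet_iff {d : ℕ} {s t : Bool} (hst : s ≠ t) {x y : Fin d → Bool} :
    (cubeGraph (d + 1)).Adj (cubeFacet d s x) (cubeFacet d t y) ↔ x = y := by
  simp [cubeGraph_adj, cubeFacet_apply, hammingDist_cons, hst]

theorem cubeFacet_ne_cubeFacet {d : ℕ} {s t : Bool} (hst : s ≠ t) (x y : Fin d → Bool) :
    cubeFacet d s x ≠ cubeFacet d t y := fun h => hst (by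
  simpa [cubeFacet_apply] using congrFun h 0)

theorem disjoint_map_cubeFacet {d : ℕ} {s t : Bool} (hst : s ≠ t) (X Y : Finset (Fin d → Bool)) :
    Disjoint (X.map (cubeFacet d s).toEmbedding) (Y.map (cubeFacet d t).toEmbedding) := by
  rw [Finset.disjoint_left]
  intro z hz hz'
  obtain ⟨x, _, rfl⟩ := Finset.mem_map.1 hz
  obtain ⟨y, _, hy⟩ := Finset.mem_map.1 hz'
  exact cubeFacet_ne_cubeFacet hst x y hy.symm

/-- A leading one flips the parity, so a class of the larger cube consists of opposite classes on
its two facets. -/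
theorem cubeParityClass_succ (d : ℕ) (p : ZMod 2) :
    cubeParityClass (d + 1) p = (cubeParityClass d p).map (cubeFacet d false).toEmbedding ∪
      (cubeParityClass d (p + 1)).map (cubeFacet d true).toEmbedding := by
  have key : ∀ q r : ZMod 2, 1 + q = r ↔ q = r + 1 := by decide
  ext z
  rw [Finset.mem_union, Finset.mem_map, Finset.mem_map]
  simp only [mem_cubeParityClass]
  constructor
  · intro h
    rw [← Fin.cons_self_tail z, cubeParity_cons] at h
    cases hz : z 0
    · refine Or.inl ⟨Fin.tail z, by simpa [hz] using h, ?_⟩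
      change Fin.cons false (Fin.tail z) = z
      rw [← hz, Fin.cons_self_tail]
    · refine Or.inr ⟨Fin.tail z, by simpa [hz, key] using h, ?_⟩
      change Fin.cons true (Fin.tail z) = z
      rw [← hz, Fin.cons_self_tail]
  · rintro (⟨x, hx, rfl⟩ | ⟨x, hx, rfl⟩)
    · change cubeParity (Fin.cons false x : Fin (d + 1) → Bool) = p
      simpa [cubeParity_cons] using hx
    · change cubeParity (Fin.cons true x : Fin (d + 1) → Bool) = p
      simpa [cubeParity_cons, key] using hx

theorem sum_cubeParityClass_succ (d : ℕ) (p : ZMod 2) (g : (Fin (d + 1) → Bool) → ℝ) :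
    ∑ z ∈ cubeParityClass (d + 1) p, g z = ∑ x ∈ cubeParityClass d p, g (cubeFacet d false x) +
      ∑ x ∈ cubeParityClass d (p + 1), g (cubeFacet d true x) := by
  rw [cubeParityClass_succ, Finset.sum_union (disjoint_map_cubeFacet (by simp) _ _),
    Finset.sum_map, Finset.sum_map]
  rfl

theorem sum_eq_sum_cubeParityClass (d : ℕ) (p : ZMod 2) (g : (Fin d → Bool) → ℝ) :
    ∑ x, g x = ∑ x ∈ cubeParityClass d p, g x + ∑ x ∈ cubeParityClass d (p + 1), g x := by
  have key : ∀ q r : ZMod 2, q = r + 1 ↔ ¬ q = r := by decide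
  simp only [cubeParityClass, key]
  exact (Finset.sum_filter_add_sum_filter_not _ _ _).symm

theorem add_one_add_one_zmod_two (p : ZMod 2) : p + 1 + 1 = p := by
  revert p
  decide

theorem sum_cube_succ (d : ℕ) (g : (Fin (d + 1) → Bool) → ℝ) :
    ∑ z, g z = ∑ x, g (cubeFacet d false x) + ∑ x, g (cubeFacet d true x) := by
  rw [sum_eq_sum_cubeParityClass (d + 1) 0, sum_cubeParityClass_succ, sum_cubeParityClass_succ,
    sum_eq_sum_cubeParityClass d 0, sum_eq_sum_cubeParityClass d 0, add_one_add_one_zmod_two]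
  ring

theorem card_cubeParityClass_succ (d : ℕ) (p : ZMod 2) :
    (cubeParityClass (d + 1) p).card = 2 ^ d := by
  -- Summing the constant `1`: a class of the larger cube has as many elements as both classes of
  -- the smaller one together.
  have h1 := sum_cubeParityClass_succ d p (fun _ => 1)
  have h2 := sum_eq_sum_cubeParityClass d p (fun _ => 1)
  rw [← h2] at h1
  simp only [Finset.sum_const, nsmul_eq_mul, mul_one, Finset.card_univ] at h1
  rw [Fintype.card_fun, Fintype.card_bool, Fintype.card_fin] at h1
  exact_mod_cast h1

/-- Every vertex of a cube of positive dimension has a neighbour. -/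
theorem exists_cubeGraph_adj {d : ℕ} (x : Fin (d + 1) → Bool) : ∃ y, (cubeGraph (d + 1)).Adj x y :=
  ⟨cubeFacet d (!(x 0)) (Fin.tail x), by
    have := (cubeFacet_adj_cubeFacet_iff (d := d) (s := x 0) (t := !(x 0)) (by simp)
      (x := Fin.tail x) (y := Fin.tail x)).2 rfl
    rwa [cubeFacet_apply (x 0), Fin.cons_self_tail] at this⟩

theorem not_isIndepSet_insert_cubeParityClass {d : ℕ} {p : ZMod 2} {x : Fin (d + 1) → Bool}
    (hx : x ∈ cubeParityClass (d + 1) (p + 1)) :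
    ¬ (cubeGraph (d + 1)).IsIndepSet
      ((insert x (cubeParityClass (d + 1) p) : Finset _) : Set (Fin (d + 1) → Bool)) := by
  obtain ⟨y, hy⟩ := exists_cubeGraph_adj x
  intro h
  refine h (by simp) ?_ hy.ne hy
  have := cubeParity_eq_add_one_of_adj hy
  rw [mem_cubeParityClass.1 hx, add_one_add_one_zmod_two] at this
  simp [mem_cubeParityClass, this]

/-- The gain from one edge joining two opposite facets. -/
theorem IsSecretPolymatroid.facets_add_one_le {d : ℕ} {f : Finset (Fin (d + 2) → Bool) → ℝ}
    (hf : IsSecretPolymatroid (cubeGraph (d + 2)) f) {s t : Bool} (hst : s ≠ t) (p : ZMod 2)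
    {x : Fin (d + 1) → Bool} (hx : x ∈ cubeParityClass (d + 1) p) :
    f (insert (cubeFacet (d + 1) t x)
        ((cubeParityClass (d + 1) p).map (cubeFacet (d + 1) s).toEmbedding ∪
          (cubeParityClass (d + 1) (p + 1)).map (cubeFacet (d + 1) t).toEmbedding)) +
      f (((cubeParityClass (d + 1) p).map (cubeFacet (d + 1) s).toEmbedding).erase
        (cubeFacet (d + 1) s x)) +
      f ((cubeParityClass (d + 1) (p + 1)).map (cubeFacet (d + 1) t).toEmbedding) + 1 ≤
    f (insert (cubeFacet (d + 1) t x)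
        ((cubeParityClass (d + 1) (p + 1)).map (cubeFacet (d + 1) t).toEmbedding)) +
      f (((cubeParityClass (d + 1) p).map (cubeFacet (d + 1) s).toEmbedding ∪
          (cubeParityClass (d + 1) (p + 1)).map (cubeFacet (d + 1) t).toEmbedding).erase
        (cubeFacet (d + 1) s x)) +
      f ((cubeParityClass (d + 1) p).map (cubeFacet (d + 1) s).toEmbedding) := by
  have hp : p ≠ p + 1 := by simp
  have hxp := mem_cubeParityClass.1 hx
  refine hf.add_one_le_of_adj (disjoint_map_cubeFacet hst _ _) ?_ ?_ ?_
    ((cubeFacet_adj_cubeFacet_iff hst).2 rfl) ?_ ?_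
  · exact Finset.mem_map_of_mem (cubeFacet (d + 1) s).toEmbedding hx
  · intro h
    obtain ⟨y, _, hy⟩ := Finset.mem_map.1 h
    exact cubeFacet_ne_cubeFacet hst y x hy
  · intro h
    obtain ⟨y, hy, hyx⟩ := Finset.mem_map.1 h
    rw [(cubeFacet (d + 1) t).injective hyx, mem_cubeParityClass, hxp] at hy
    exact hp hy
  -- The only neighbour of `(t, x)` in the opposite facet is `(s, x)`, which has been erased.
  · have hcross : ∀ z ∈ ((cubeParityClass (d + 1) p).map (cubeFacet (d + 1) s).toEmbedding).erase
        (cubeFacet (d + 1) s x), ¬ (cubeGraph (d + 2)).Adj z (cubeFacet (d + 1) t x) := by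
      intro z hz h
      obtain ⟨hzx, hz⟩ := Finset.mem_erase.1 hz
      obtain ⟨y, _, rfl⟩ := Finset.mem_map.1 hz
      exact hzx (by rw [← (cubeFacet_adj_cubeFacet_iff hst).1 h]; rfl)
    intro u hu v hv huv hadj
    rcases Finset.mem_insert.1 (Finset.mem_coe.1 hu) with rfl | hu <;>
      rcases Finset.mem_insert.1 (Finset.mem_coe.1 hv) with rfl | hv
    · exact huv rfl
    · exact hcross _ hv hadj.symm
    · exact hcross _ hu hadj
    · obtain ⟨u, hu', rfl⟩ := Finset.mem_map.1 (Finset.mem_erase.1 hu).2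
      obtain ⟨v, hv', rfl⟩ := Finset.mem_map.1 (Finset.mem_erase.1 hv).2
      have hadj : (cubeGraph (d + 1)).Adj u v := (cubeFacet (d + 1) s).map_adj_iff.1 hadj
      exact isIndepSet_cubeParityClass (d + 1) p (Finset.mem_coe.2 hu') (Finset.mem_coe.2 hv')
        hadj.ne hadj
  · have hx' : x ∈ cubeParityClass (d + 1) (p + 1 + 1) := by rwa [add_one_add_one_zmod_two]
    intro h
    refine not_isIndepSet_insert_cubeParityClass hx' fun u hu v hv huv hadj => ?_
    refine h ?_ ?_ ((cubeFacet (d + 1) t).injective.ne huv)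
      ((cubeFacet (d + 1) t).map_adj_iff.2 hadj)
    · have := Finset.mem_map_of_mem (cubeFacet (d + 1) t).toEmbedding (Finset.mem_coe.1 hu)
      rwa [Finset.map_insert] at this
    · have := Finset.mem_map_of_mem (cubeFacet (d + 1) t).toEmbedding (Finset.mem_coe.1 hv)
      rwa [Finset.map_insert] at this

/-- Apply the induction hypothesis to the two facets with opposite parities and add the gain of each
of the `2 ^ (d + 1)` edges between them: `(d + 1) * 2 ^ (d + 1)` is twice `d * 2 ^ d` plus that
number. -/
theorem IsSecretPolymatroid.cube_sum_insert_le :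
    ∀ (d : ℕ) {f : Finset (Fin (d + 1) → Bool) → ℝ},
    IsSecretPolymatroid (cubeGraph (d + 1)) f → ∀ p : ZMod 2,
    ∑ x ∈ cubeParityClass (d + 1) (p + 1), f (insert x (cubeParityClass (d + 1) p)) + d * 2 ^ d ≤
      ∑ x ∈ cubeParityClass (d + 1) p, f ((cubeParityClass (d + 1) p).erase x) + ∑ x, f {x}
  | 0, f, hf, p => by
    obtain ⟨a, ha⟩ := Finset.card_eq_one.1 (card_cubeParityClass_succ 0 p)
    obtain ⟨b, hb⟩ := Finset.card_eq_one.1 (card_cubeParityClass_succ 0 (p + 1))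
    rw [sum_eq_sum_cubeParityClass (0 + 1) p, ha, hb]
    have h := hf.submodular {b} {a}
    have h' := hf.mono ∅ _ (Finset.empty_subset ({b} ∩ {a}))
    -- Through `h'` and `h0` the intersection term is nonnegative, with no need to know that `a` and
    -- `b` differ.
    have h0 := hf.empty_nonneg
    have e : ({b} : Finset (Fin (0 + 1) → Bool)) ∪ {a} = insert b {a} := rfl
    rw [e] at h
    simp only [Finset.sum_singleton, Finset.erase_singleton]
    push_cast
    linarith
  | d + 1, f, hf, p => by
    have ih0 := IsSecretPolymatroid.cube_sum_insert_le d (hf.comap (cubeFacet (d + 1) false)) p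
    have ih1 := IsSecretPolymatroid.cube_sum_insert_le d (hf.comap (cubeFacet (d + 1) true)) (p + 1)
    -- `g0` and `g1` exchange the roles of the facets. The values of `f` on the two halves of the
    -- class enter them with opposite signs and cancel, as all classes have size `2 ^ d`.
    have g0 := Finset.sum_le_sum fun x (hx : x ∈ cubeParityClass (d + 1) p) =>
      hf.facets_add_one_le (s := false) (t := true) (by simp) p hx
    have g1 := Finset.sum_le_sum fun x (hx : x ∈ cubeParityClass (d + 1) (p + 1)) =>
      hf.facets_add_one_le (s := true) (t := false) (by simp) (p + 1) hx
    rw [sum_cubeParityClass_succ (d + 1), sum_cubeParityClass_succ (d + 1), sum_cube_succ,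
      cubeParityClass_succ (d + 1) p]
    simp only [add_one_add_one_zmod_two, Finset.map_insert, Finset.map_erase,
      Finset.map_singleton, RelEmbedding.coe_toEmbedding] at ih0 ih1 g0 g1 ⊢
    rw [Finset.union_comm (Finset.map (cubeFacet (d + 1) true).toEmbedding _)] at g1
    simp only [Finset.sum_add_distrib, Finset.sum_const, card_cubeParityClass_succ,
      nsmul_eq_mul, mul_one] at g0 g1
    push_cast at g0 g1 ⊢
    rw [pow_succ]
    linarith

theorem IsSecretPolymatroid.cube_sum_singleton_ge {d : ℕ} (hd : 1 ≤ d)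
    {f : Finset (Fin d → Bool) → ℝ} (hf : IsSecretPolymatroid (cubeGraph d) f) :
    (d / 2 : ℝ) * 2 ^ d ≤ ∑ x, f {x} := by
  obtain ⟨d, rfl⟩ := Nat.exists_eq_add_of_le' hd
  have h := hf.cube_sum_insert_le d 0
  -- Each of the `2 ^ d` insertions gains `1` over `f A`, which raises the coefficient from `d` to
  -- `d + 1`.
  have h1 : ∑ x ∈ cubeParityClass (d + 1) (0 + 1), (f (cubeParityClass (d + 1) 0) + 1) ≤
      ∑ x ∈ cubeParityClass (d + 1) (0 + 1), f (insert x (cubeParityClass (d + 1) 0)) :=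
    Finset.sum_le_sum fun x hx => hf.strict_mono _ _ (Finset.subset_insert _ _)
      (isIndepSet_cubeParityClass _ _) (not_isIndepSet_insert_cubeParityClass hx)
  have h2 : ∑ x ∈ cubeParityClass (d + 1) 0, f ((cubeParityClass (d + 1) 0).erase x) ≤
      ∑ x ∈ cubeParityClass (d + 1) 0, f (cubeParityClass (d + 1) 0) :=
    Finset.sum_le_sum fun x _ => hf.mono _ _ (Finset.erase_subset _ _)
  simp only [Finset.sum_const, card_cubeParityClass_succ, nsmul_eq_mul] at h1 h2
  push_cast at h1 h2 ⊢
  rw [pow_succ]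
  linarith

end Cube

/-! ### From a scheme to a polymatroid. -/

/-- Submodularity of entropy, for a variable `W` determined by `X` and `Y` together and a variable
`Z` determined by each of them. -/
theorem shannonEntropy_add_le_of_determined {Ω : Type*} [MeasurableSpace Ω] {μ : Measure Ω}
    [IsFiniteMeasure μ] {S T U R : Type*} [Fintype S] [Fintype T] [Fintype U] [Fintype R]
    [MeasurableSpace S] [MeasurableSingletonClass S] [MeasurableSpace T]
    [MeasurableSingletonClass T] [MeasurableSpace U] [MeasurableSingletonClass U]
    [MeasurableSpace R] [MeasurableSingletonClass R]
    {X : Ω → S} {Y : Ω → T} {Z : Ω → U} {W : Ω → R} (hX : Measurable X) (hY : Measurable Y)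
    (hZ : Measurable Z) (hW : Measurable W) (w : S → T → R) (hw : ∀ ω, W ω = w (X ω) (Y ω))
    (z : S → U) (hz : ∀ ω, Z ω = z (X ω)) (z' : T → U) (hz' : ∀ ω, Z ω = z' (Y ω)) :
    shannonEntropy μ W + shannonEntropy μ Z ≤ shannonEntropy μ X + shannonEntropy μ Y :=
  calc _ ≤ shannonEntropy μ (fun ω => ((Z ω, X ω), Y ω)) + shannonEntropy μ Z :=
        add_le_add_left (shannonEntropy_le_of_comp hW ((hZ.prodMk hX).prodMk hY)
          (fun q => w q.1.2 q.2) hw) _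
    _ ≤ _ := shannonEntropy_submodular hX hY hZ
    _ ≤ _ := add_le_add
        (shannonEntropy_le_of_comp (hZ.prodMk hX) hX (fun x => (z x, x)) fun ω => by rw [hz])
        (shannonEntropy_le_of_comp (hZ.prodMk hY) hY (fun y => (z' y, y)) fun ω => by rw [hz'])

namespace PerfectSecretSharingScheme

variable {V : Type*} {G : SimpleGraph V} (𝒮 : PerfectSecretSharingScheme G)

/-- The shares of a finite set of vertices, as one random variable. -/
def jointShare (X : Finset V) (ω : 𝒮.Ω) (v : X) : 𝒮.Share v := 𝒮.share v ω

theorem measurable_jointShare (X : Finset V) : Measurable (𝒮.jointShare X) :=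
  measurable_pi_lambda _ fun v => 𝒮.measurable_share v

theorem indepFun_secret_jointShare {X : Finset V} (hX : G.IsIndepSet (X : Set V)) :
    IndepFun 𝒮.secret (𝒮.jointShare X) 𝒮.μ :=
  (𝒮.indep_of_isIndepSet X hX).comp measurable_id
    (measurable_pi_lambda _ fun (v : X) => measurable_pi_apply (⟨v, v.2⟩ : (X : Set V)))

theorem exists_decode {X : Finset V} (hX : ¬ G.IsIndepSet (X : Set V)) :
    ∃ g : (∀ v : X, 𝒮.Share v) → 𝒮.Secret, ∀ᵐ ω ∂𝒮.μ, 𝒮.secret ω = g (𝒮.jointShare X ω) := by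
  simp only [SimpleGraph.isIndepSet_iff, Set.Pairwise, not_forall, not_not] at hX
  obtain ⟨v, hv, w, hw, _, hadj⟩ := hX
  obtain ⟨decode, h⟩ := 𝒮.edge_determines v w hadj
  exact ⟨fun s => decode (s ⟨v, hv⟩) (s ⟨w, hw⟩), h⟩

theorem shannonEntropy_div_nonneg (v : V) :
    0 ≤ shannonEntropy 𝒮.μ (𝒮.share v) / shannonEntropy 𝒮.μ 𝒮.secret :=
  div_nonneg (shannonEntropy_nonneg _) 𝒮.entropy_secret_pos.le

theorem ratio_nonneg : 0 ≤ 𝒮.ratio := Real.iSup_nonneg 𝒮.shannonEntropy_div_nonneg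

variable [DecidableEq V]

theorem shannonEntropy_secret_jointShare_of_not_isIndepSet {X : Finset V}
    (hX : ¬ G.IsIndepSet (X : Set V)) :
    shannonEntropy 𝒮.μ (fun ω => (𝒮.secret ω, 𝒮.jointShare X ω)) =
      shannonEntropy 𝒮.μ (𝒮.jointShare X) := by
  obtain ⟨g, hg⟩ := 𝒮.exists_decode hX
  exact shannonEntropy_prodMk_of_ae_eq g hg

theorem shannonEntropy_secret_jointShare_of_isIndepSet {X : Finset V}
    (hX : G.IsIndepSet (X : Set V)) :
    shannonEntropy 𝒮.μ (fun ω => (𝒮.secret ω, 𝒮.jointShare X ω)) =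
      shannonEntropy 𝒮.μ 𝒮.secret + shannonEntropy 𝒮.μ (𝒮.jointShare X) :=
  shannonEntropy_prodMk_of_indepFun 𝒮.measurable_secret (𝒮.measurable_jointShare X)
    (𝒮.indepFun_secret_jointShare hX)

theorem shannonEntropy_jointShare_submodular (X Y : Finset V) :
    shannonEntropy 𝒮.μ (𝒮.jointShare (X ∪ Y)) + shannonEntropy 𝒮.μ (𝒮.jointShare (X ∩ Y)) ≤
      shannonEntropy 𝒮.μ (𝒮.jointShare X) + shannonEntropy 𝒮.μ (𝒮.jointShare Y) := by
  refine shannonEntropy_add_le_of_determined (𝒮.measurable_jointShare _)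
    (𝒮.measurable_jointShare _) (𝒮.measurable_jointShare _) (𝒮.measurable_jointShare _)
    (fun s t v => if h : v.1 ∈ X then s ⟨v, h⟩ else
      t ⟨v, (Finset.mem_union.1 v.2).resolve_left h⟩) ?_
    (fun s v => s ⟨v, (Finset.mem_inter.1 v.2).1⟩) (fun _ => rfl)
    (fun t v => t ⟨v, (Finset.mem_inter.1 v.2).2⟩) (fun _ => rfl)
  intro ω
  funext v
  by_cases h : v.1 ∈ X <;> simp [h, jointShare]

theorem shannonEntropy_secret_jointShare_submodular (X Y : Finset V) :
    shannonEntropy 𝒮.μ (fun ω => (𝒮.secret ω, 𝒮.jointShare (X ∪ Y) ω)) +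
      shannonEntropy 𝒮.μ (fun ω => (𝒮.secret ω, 𝒮.jointShare (X ∩ Y) ω)) ≤
    shannonEntropy 𝒮.μ (fun ω => (𝒮.secret ω, 𝒮.jointShare X ω)) +
      shannonEntropy 𝒮.μ (fun ω => (𝒮.secret ω, 𝒮.jointShare Y ω)) := by
  have hm := fun X => 𝒮.measurable_secret.prodMk (𝒮.measurable_jointShare X)
  refine shannonEntropy_add_le_of_determined (hm _) (hm _) (hm _) (hm _)
    (fun s t => (s.1, fun v => if h : v.1 ∈ X then s.2 ⟨v, h⟩ else
      t.2 ⟨v, (Finset.mem_union.1 v.2).resolve_left h⟩)) ?_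
    (fun s => (s.1, fun v => s.2 ⟨v, (Finset.mem_inter.1 v.2).1⟩)) (fun _ => rfl)
    (fun t => (t.1, fun v => t.2 ⟨v, (Finset.mem_inter.1 v.2).2⟩)) (fun _ => rfl)
  intro ω
  refine Prod.ext rfl (funext fun v => ?_)
  by_cases h : v.1 ∈ X <;> simp [h, jointShare]

/-- The two strict properties are monotonicity and submodularity of the entropy of the secret
together with the shares: the secret adds its whole entropy on an independent set and nothing on a
set containing an edge. -/
theorem isSecretPolymatroid : IsSecretPolymatroid G (fun X =>
    shannonEntropy 𝒮.μ (𝒮.jointShare X) / shannonEntropy 𝒮.μ 𝒮.secret) := by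
  have hpos := 𝒮.entropy_secret_pos
  have hmono : ∀ X Y : Finset V, X ⊆ Y →
      shannonEntropy 𝒮.μ (𝒮.jointShare X) ≤ shannonEntropy 𝒮.μ (𝒮.jointShare Y) :=
    fun X Y h => shannonEntropy_le_of_comp (𝒮.measurable_jointShare X) (𝒮.measurable_jointShare Y)
      (fun s v => s ⟨v, h v.2⟩) fun _ => rfl
  constructor
  · exact div_nonneg (shannonEntropy_nonneg _) hpos.le
  · intro X Y
    rw [← add_div, ← add_div]
    exact div_le_div_of_nonneg_right (𝒮.shannonEntropy_jointShare_submodular X Y) hpos.le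
  · intro X Y h
    exact div_le_div_of_nonneg_right (hmono X Y h) hpos.le
  · intro X Y h hX hY
    rw [← div_self hpos.ne', ← add_div]
    refine div_le_div_of_nonneg_right ?_ hpos.le
    rw [add_comm, ← 𝒮.shannonEntropy_secret_jointShare_of_isIndepSet hX,
      ← 𝒮.shannonEntropy_secret_jointShare_of_not_isIndepSet hY]
    exact shannonEntropy_le_of_comp (𝒮.measurable_secret.prodMk (𝒮.measurable_jointShare X))
      (𝒮.measurable_secret.prodMk (𝒮.measurable_jointShare Y))
      (fun s => (s.1, fun v => s.2 ⟨v, h v.2⟩)) fun _ => rfl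
  · intro X Y hX hY hXY
    rw [← div_self hpos.ne', ← add_div, ← add_div, ← add_div]
    refine div_le_div_of_nonneg_right ?_ hpos.le
    have hunion : ¬ G.IsIndepSet ((X ∪ Y : Finset V) : Set V) :=
      fun h => hX (h.mono (by simp))
    have := 𝒮.shannonEntropy_secret_jointShare_submodular X Y
    rw [𝒮.shannonEntropy_secret_jointShare_of_isIndepSet hXY,
      𝒮.shannonEntropy_secret_jointShare_of_not_isIndepSet hX,
      𝒮.shannonEntropy_secret_jointShare_of_not_isIndepSet hY,
      𝒮.shannonEntropy_secret_jointShare_of_not_isIndepSet hunion] at this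
    linarith

theorem shannonEntropy_jointShare_singleton_le (v : V) :
    shannonEntropy 𝒮.μ (𝒮.jointShare {v}) ≤ shannonEntropy 𝒮.μ (𝒮.share v) :=
  shannonEntropy_le_of_comp (𝒮.measurable_jointShare {v}) (𝒮.measurable_share v)
    (fun s w => (Finset.mem_singleton.1 w.2).symm ▸ s) fun ω => by
      funext ⟨w, hw⟩
      obtain rfl := Finset.mem_singleton.1 hw
      rfl

/-- A scheme for a graph that contains the `d`-cube as an induced subgraph has ratio at least
`d / 2`. -/
theorem half_le_ratio_of_cubeGraph_embedding [Finite V] {d : ℕ} (hd : 1 ≤ d)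
    (φ : cubeGraph d ↪g G) : (d / 2 : ℝ) ≤ 𝒮.ratio := by
  have h := (𝒮.isSecretPolymatroid.comap φ).cube_sum_singleton_ge hd
  have hle : ∀ x, shannonEntropy 𝒮.μ (𝒮.jointShare (Finset.map φ.toEmbedding {x})) /
      shannonEntropy 𝒮.μ 𝒮.secret ≤ 𝒮.ratio := fun x =>
    (div_le_div_of_nonneg_right (𝒮.shannonEntropy_jointShare_singleton_le (φ x))
      𝒮.entropy_secret_pos.le).trans
      (le_ciSup (f := fun v => shannonEntropy 𝒮.μ (𝒮.share v) / shannonEntropy 𝒮.μ 𝒮.secret)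
        (Set.finite_range _).bddAbove (φ x))
  -- The maximum is at least the average over the `2 ^ d` vertices of the cube.
  have h' := h.trans (Finset.sum_le_sum fun x _ => hle x)
  simp only [Finset.sum_const, Finset.card_univ, Fintype.card_fun, Fintype.card_bool,
    Fintype.card_fin, nsmul_eq_mul] at h'
  push_cast at h'
  rw [mul_comm] at h'
  exact le_of_mul_le_mul_left h' (by positivity)

end PerfectSecretSharingScheme

/-! ### Uniform distributions on finite products. -/

section Uniform

theorem uniformOn_univ_real {Ω : Type*} [Fintype Ω] [MeasurableSpace Ω]
    [DiscreteMeasurableSpace Ω] (s : Set Ω) :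
    (uniformOn (Set.univ : Set Ω)).real s = s.ncard / Fintype.card Ω := by
  rw [measureReal_def, uniformOn_univ, Measure.count_apply (MeasurableSet.of_discrete),
    ENNReal.toReal_div,
    ← s.toFinite.cast_ncard_eq, ENat.toENNReal_coe, ENNReal.toReal_natCast, ENNReal.toReal_natCast]

variable {R T : Type*} [Fintype R] [MeasurableSpace R] [Fintype T] [MeasurableSpace T]
  [DiscreteMeasurableSpace (R × T)]

theorem uniformOn_univ_real_prod (e : R × T ≃ R × T) (a : Set R) (b : Set T) :
    (uniformOn (Set.univ : Set (R × T))).real (e ⁻¹' (a ×ˢ b)) =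
      (a.ncard / Fintype.card R) * (b.ncard / Fintype.card T) := by
  rw [uniformOn_univ_real, ← e.image_symm_eq_preimage, Set.ncard_image_of_injective _ e.symm.injective,
    Set.ncard_prod, Fintype.card_prod]
  push_cast
  rw [mul_div_mul_comm]

/-- Under the uniform distribution on `R × T`, the first coordinate is independent of the second
coordinate of any permutation that fixes first coordinates. -/
theorem indepFun_fst_snd_equiv [Nonempty R] [Nonempty T] (e : R × T ≃ R × T)
    (he : ∀ ω, (e ω).1 = ω.1) :
    IndepFun (Prod.fst : R × T → R) (fun ω => (e ω).2) (uniformOn (Set.univ : Set (R × T))) := by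
  have : IsProbabilityMeasure (uniformOn (Set.univ : Set (R × T))) :=
    isProbabilityMeasure_uniformOn Set.finite_univ Set.univ_nonempty
  have hR : (Fintype.card R : ℝ) ≠ 0 := by exact_mod_cast Fintype.card_ne_zero
  have hT : (Fintype.card T : ℝ) ≠ 0 := by exact_mod_cast Fintype.card_ne_zero
  rw [indepFun_iff_measure_inter_preimage_eq_mul]
  intro a b _ _
  have h1 : Prod.fst ⁻¹' a ∩ (fun ω => (e ω).2) ⁻¹' b = e ⁻¹' (a ×ˢ b) := by
    ext ω
    simp [he]
  have h2 : (Prod.fst : R × T → R) ⁻¹' a = e ⁻¹' (a ×ˢ Set.univ) := by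
    ext ω
    simp [he]
  have h3 : (fun ω => (e ω).2) ⁻¹' b = e ⁻¹' (Set.univ ×ˢ b) := by
    ext ω
    simp
  rw [h1, h2, h3, ← ENNReal.toReal_eq_toReal_iff' (by finiteness) (by finiteness),
    ENNReal.toReal_mul]
  simp only [← measureReal_def, uniformOn_univ_real_prod, Set.ncard_univ, Nat.card_eq_fintype_card,
    div_self hR, div_self hT, mul_one, one_mul]

theorem shannonEntropy_fst_uniformOn [Nonempty T] [DiscreteMeasurableSpace (Bool × T)] :
    shannonEntropy (uniformOn (Set.univ : Set (Bool × T))) (Prod.fst : Bool × T → Bool) = 1 := by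
  have hT : (Fintype.card T : ℝ) ≠ 0 := by exact_mod_cast Fintype.card_ne_zero
  have h : ∀ b : Bool, (uniformOn (Set.univ : Set (Bool × T))).real (Prod.fst ⁻¹' {b}) = 2⁻¹ := by
    intro b
    have h2 : (Prod.fst : Bool × T → Bool) ⁻¹' {b} =
        (Equiv.refl _) ⁻¹' (({b} : Set Bool) ×ˢ (Set.univ : Set T)) := by
      ext ω
      simp
    rw [h2, uniformOn_univ_real_prod]
    simp [Set.ncard_univ, hT]
  have hlog : Real.log 2 ≠ 0 := (Real.log_pos one_lt_two).ne'
  simp only [shannonEntropy, h, Real.negMulLog, Real.log_inv, Fintype.sum_bool]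
  field_simp
  norm_num

end Uniform

/-! ### Schemes from covers by complete bipartite graphs. -/

section Biclique

open Classical in
/-- The secret is a uniform bit `s`; for every complete bipartite graph `(A i, B i)` of a cover of
the edges there is an independent uniform bit `r i`, which is given to `A i`, while `B i` gets
`r i + s`. -/
noncomputable def bicliqueCoverScheme {V : Type*} {G : SimpleGraph V} {I : Type} [Fintype I]
    (A B : I → Set V) (hadj : ∀ i, ∀ a ∈ A i, ∀ b ∈ B i, G.Adj a b)
    (hcover : ∀ v w, G.Adj v w → ∃ i, (v ∈ A i ∧ w ∈ B i) ∨ (v ∈ B i ∧ w ∈ A i)) :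
    PerfectSecretSharingScheme G where
  Ω := Bool × (I → Bool)
  μ := uniformOn Set.univ
  isProbabilityMeasure := isProbabilityMeasure_uniformOn Set.finite_univ Set.univ_nonempty
  Secret := Bool
  Share v := {i // v ∈ A i ∪ B i} → Bool
  secret := Prod.fst
  measurable_secret := measurable_fst
  share v ω i := if v ∈ B i then xor (ω.2 i) ω.1 else ω.2 i
  measurable_share _ := Measurable.of_discrete
  edge_determines v w h := by
    obtain ⟨i, hi⟩ := hcover v w h
    have hdisj : ∀ u, u ∈ A i → u ∉ B i := fun u ha hb => (hadj i u ha u hb).ne rfl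
    rcases hi with ⟨hv, hw⟩ | ⟨hv, hw⟩
    · refine ⟨fun s t => xor (s ⟨i, Or.inl hv⟩) (t ⟨i, Or.inr hw⟩), ae_of_all _ fun ω => ?_⟩
      simp [hw, hdisj v hv]
    · refine ⟨fun s t => xor (s ⟨i, Or.inr hv⟩) (t ⟨i, Or.inl hw⟩), ae_of_all _ fun ω => ?_⟩
      cases ω.1 <;> cases h2 : ω.2 i <;> simp [hv, hdisj w hw, h2]
  indep_of_isIndepSet X hX := by
    -- Add the secret to every `r i` for which `X` meets `B i`. An independent `X` cannot meet both
    -- `A i` and `B i`, so its shares are read off from the second component of `g`. As `g` permutes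
    -- the sample space and fixes the secret, that component is independent of the secret.
    let g : Bool × (I → Bool) → Bool × (I → Bool) := fun ω =>
      (ω.1, fun i => if ∃ v ∈ X, v ∈ B i then xor (ω.2 i) ω.1 else ω.2 i)
    have hg : Function.Involutive g := by
      intro ω
      refine Prod.ext rfl (funext fun i => ?_)
      by_cases h : ∃ v ∈ X, v ∈ B i <;> simp [g, h]
    have hind := indepFun_fst_snd_equiv (Function.Involutive.toPerm g hg) (fun _ => rfl)
    have heq : (fun (ω : Bool × (I → Bool)) (v : X) (i : {i // v.1 ∈ A i ∪ B i}) =>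
        if v.1 ∈ B i then xor (ω.2 i) ω.1 else ω.2 i) =
        (fun (r : I → Bool) (v : X) (i : {i // v.1 ∈ A i ∪ B i}) => r i) ∘
          fun ω : Bool × (I → Bool) => (Function.Involutive.toPerm g hg ω).2 := by
      funext ω v i
      change _ = if ∃ v ∈ X, v ∈ B i then xor (ω.2 i) ω.1 else ω.2 i
      by_cases hv : v.1 ∈ B i
      · rw [if_pos hv, if_pos ⟨v, v.2, hv⟩]
      · have hvA : v.1 ∈ A i := i.2.resolve_right hv
        rw [if_neg hv, if_neg]
        rintro ⟨w, hw, hwB⟩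
        have := hadj i v hvA w hwB
        exact hX v.2 hw this.ne this
    rw [heq]
    exact hind.comp measurable_id Measurable.of_discrete
  entropy_secret_pos := by
    rw [shannonEntropy_fst_uniformOn]
    exact one_pos

theorem bicliqueCoverScheme_ratio_le {V : Type*} {G : SimpleGraph V} {I : Type} [Fintype I]
    (A B : I → Set V) (hadj : ∀ i, ∀ a ∈ A i, ∀ b ∈ B i, G.Adj a b)
    (hcover : ∀ v w, G.Adj v w → ∃ i, (v ∈ A i ∧ w ∈ B i) ∨ (v ∈ B i ∧ w ∈ A i)) {c : ℝ}
    (hc : 0 ≤ c) (hcard : ∀ v, ({i | v ∈ A i ∪ B i}.ncard : ℝ) ≤ c) :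
    (bicliqueCoverScheme A B hadj hcover).ratio ≤ c := by
  classical
  refine Real.iSup_le (fun v => ?_) hc
  have h1 : shannonEntropy (bicliqueCoverScheme A B hadj hcover).μ
      (bicliqueCoverScheme A B hadj hcover).secret = 1 := shannonEntropy_fst_uniformOn
  rw [h1, div_one]
  refine (shannonEntropy_le_logb_card
    ((bicliqueCoverScheme A B hadj hcover).measurable_share v)).trans ((le_of_eq ?_).trans (hcard v))
  have h2 : Fintype.card ((bicliqueCoverScheme A B hadj hcover).Share v) =
      2 ^ {i | v ∈ A i ∪ B i}.ncard := by
    rw [← Nat.card_eq_fintype_card]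
    change Nat.card ({i // v ∈ A i ∪ B i} → Bool) = _
    rw [Nat.card_fun, Nat.card_eq_fintype_card, Fintype.card_bool]
    rfl
  rw [h2]
  push_cast
  rw [Real.logb_pow, Real.logb_self_eq_one one_lt_two, mul_one]

theorem informationRatio_le_of_bicliqueCover {V : Type*} {G : SimpleGraph V} {I : Type} [Fintype I]
    (A B : I → Set V) (hadj : ∀ i, ∀ a ∈ A i, ∀ b ∈ B i, G.Adj a b)
    (hcover : ∀ v w, G.Adj v w → ∃ i, (v ∈ A i ∧ w ∈ B i) ∨ (v ∈ B i ∧ w ∈ A i)) {c : ℝ}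
    (hc : 0 ≤ c) (hcard : ∀ v, ({i | v ∈ A i ∪ B i}.ncard : ℝ) ≤ c) :
    informationRatio G ≤ c :=
  (ciInf_le ⟨0, by rintro _ ⟨𝒮, rfl⟩; exact 𝒮.ratio_nonneg⟩ _).trans
    (bicliqueCoverScheme_ratio_le A B hadj hcover hc hcard)

/-- Every finite graph has a perfect secret sharing scheme, from the cover of its edges by stars. -/
theorem nonempty_perfectSecretSharingScheme {V : Type} [Fintype V] (G : SimpleGraph V) :
    Nonempty (PerfectSecretSharingScheme G) :=
  ⟨bicliqueCoverScheme (I := V) (fun v => {v}) G.neighborSet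
    (by rintro v _ rfl b hb; exact hb)
    (fun v w h => ⟨v, Or.inl ⟨rfl, h⟩⟩)⟩

theorem half_le_informationRatio_of_cubeGraph_embedding {V : Type} [Fintype V] {G : SimpleGraph V}
    {d : ℕ} (hd : 1 ≤ d) (φ : cubeGraph d ↪g G) : (d / 2 : ℝ) ≤ informationRatio G := by
  classical
  -- Without a scheme the real infimum would be the default value `0`.
  have := nonempty_perfectSecretSharingScheme G
  exact le_ciInf fun 𝒮 => 𝒮.half_le_ratio_of_cubeGraph_embedding hd φ

end Biclique

/-! ### The block cover and the choice of block size. -/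

section UpperBound

/-- The `j`-th of the blocks of `k` consecutive vertices. -/
def vertexBlock (n k j : ℕ) : Finset (Fin n) :=
  Finset.univ.filter fun u => u.val / k = j

theorem card_vertexBlock_le {n k : ℕ} (hk : 0 < k) (j : ℕ) : (vertexBlock n k j).card ≤ k := by
  calc (vertexBlock n k j).card ≤ (Finset.Ico (k * j) (k * j + k)).card := by
        refine Finset.card_le_card_of_injOn Fin.val (fun u hu => ?_) Fin.val_injective.injOn
        have hu : u.val / k = j := by simpa [vertexBlock] using hu
        have h1 := Nat.div_add_mod u.val k
        have h2 := Nat.mod_lt u.val hk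
        rw [hu] at h1
        simp only [Finset.coe_Ico, Set.mem_Ico]
        omega
    _ = k := by simp

/-- Covering the edges by the complete bipartite graphs that join a subset `S` of a block of `k`
vertices to the vertices whose neighbours in the block are exactly those in `S`. -/
theorem informationRatio_le_of_blocks {n : ℕ} (G : SimpleGraph (Fin n)) {k : ℕ} (hk : 0 < k) :
    informationRatio G ≤ ((n / k + 1 + 2 ^ (k - 1) : ℕ) : ℝ) := by
  classical
  let nb : ℕ → Fin n → Finset (Fin n) := fun j v => (vertexBlock n k j).filter (G.Adj v)
  refine informationRatio_le_of_bicliqueCover (I := Fin (n / k + 1) × Finset (Fin n))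
    (fun i => {v | v ∈ i.2 ∧ i.2 ⊆ vertexBlock n k i.1}) (fun i => {v | nb i.1 v = i.2})
    ?_ ?_ (Nat.cast_nonneg _) ?_
  · rintro ⟨j, S⟩ a ⟨ha, _⟩ b hb
    have hb : nb j b = S := hb
    subst hb
    exact (Finset.mem_filter.1 ha).2.symm
  · intro v w h
    have hj : v.val / k < n / k + 1 := Nat.lt_succ_of_le (Nat.div_le_div_right v.2.le)
    refine ⟨(⟨v.val / k, hj⟩, nb (v.val / k) w), Or.inl ⟨⟨?_, Finset.filter_subset _ _⟩, rfl⟩⟩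
    simpa [nb, vertexBlock] using h.symm
  · intro v
    have hj : v.val / k < n / k + 1 := Nat.lt_succ_of_le (Nat.div_le_div_right v.2.le)
    have hv : v ∈ vertexBlock n k (v.val / k) := by simp [vertexBlock]
    -- The first part lists the right sides containing `v`, one per block; the second the left
    -- sides, that is, the subsets of the block of `v` that contain `v`, whence the exponent `k -
    -- 1`.
    let F : Finset (Fin (n / k + 1) × Finset (Fin n)) :=
      (Finset.univ.image fun j : Fin (n / k + 1) => (j, nb j v)) ∪
        ((vertexBlock n k (v.val / k)).erase v).powerset.image
          fun S => ((⟨v.val / k, hj⟩ : Fin (n / k + 1)), insert v S)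
    have hF : {i : Fin (n / k + 1) × Finset (Fin n) |
        v ∈ {v | v ∈ i.2 ∧ i.2 ⊆ vertexBlock n k i.1} ∪ {v | nb i.1 v = i.2}} ⊆ F := by
      rintro ⟨j, S⟩ (⟨hvS, hS⟩ | h)
      · have hjv : v.val / k = j := by simpa [vertexBlock] using hS hvS
        refine Finset.mem_coe.2 (Finset.mem_union_right _ (Finset.mem_image.2 ⟨S.erase v, ?_, ?_⟩))
        · rw [Finset.mem_powerset, hjv]
          exact Finset.erase_subset_erase v hS
        · exact Prod.ext (Fin.ext hjv) (Finset.insert_erase hvS)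
      · refine Finset.mem_coe.2 (Finset.mem_union_left _ (Finset.mem_image.2 ⟨j, by simp, ?_⟩))
        exact Prod.ext rfl h
    have hcard : F.card ≤ n / k + 1 + 2 ^ (k - 1) := by
      refine (Finset.card_union_le _ _).trans (add_le_add ?_ ?_)
      · exact Finset.card_image_le.trans (by simp)
      · refine Finset.card_image_le.trans ?_
        rw [Finset.card_powerset, Finset.card_erase_of_mem hv]
        exact Nat.pow_le_pow_right two_pos (Nat.sub_le_sub_right (card_vertexBlock_le hk _) 1)
    have := Set.ncard_le_ncard hF F.finite_toSet
    rw [Set.ncard_coe_finset] at this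
    exact_mod_cast this.trans hcard

/-- With `t = √n`, Bernoulli's inequality `t ≤ 2 ^ (t - 1)` gives `log₂ n ≤ 2 * (t - 1)`, and `(1 +
t) * 2 * (t - 1) ≤ 2 * n`. Bernoulli needs exponent at least `1`, that is `n ≥ 4`; the values `2`
and `3` are checked directly. -/
theorem one_add_sqrt_mul_logb_le {n : ℕ} (hn : 2 ≤ n) :
    (1 + √(n : ℝ)) * Real.logb 2 n ≤ 2 * n := by
  have hs : √(n : ℝ) ^ 2 = n := Real.sq_sqrt (Nat.cast_nonneg n)
  have hs0 : 0 ≤ √(n : ℝ) := Real.sqrt_nonneg _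
  rcases lt_or_ge n 4 with h4 | h4
  · interval_cases n
    · rw [Nat.cast_ofNat, Real.logb_self_eq_one one_lt_two]
      push_cast at hs hs0
      nlinarith
    · have h3 : Real.logb 2 ((3 : ℕ) : ℝ) ≤ 2 := by
        rw [Real.logb_le_iff_le_rpow one_lt_two (by norm_num)]
        norm_num
      push_cast at hs hs0 h3 ⊢
      have : √(3 : ℝ) ≤ 2 := by nlinarith
      nlinarith
  · have h2 : 2 ≤ √(n : ℝ) := Real.le_sqrt_of_sq_le (by norm_num; exact_mod_cast h4)
    have hb := one_add_mul_self_le_rpow_one_add (s := 1) (by norm_num) (p := √(n : ℝ) - 1)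
      (by linarith)
    have hlog : Real.logb 2 (√(n : ℝ)) ≤ √(n : ℝ) - 1 := by
      rw [Real.logb_le_iff_le_rpow one_lt_two (by linarith)]
      norm_num at hb
      exact hb
    have hL : Real.logb 2 (n : ℝ) = 2 * Real.logb 2 (√(n : ℝ)) := by
      conv_lhs => rw [← hs]
      rw [Real.logb_pow]
      norm_num
    rw [hL]
    nlinarith

theorem largestInformationRatio_le {n : ℕ} (hn : 2 ≤ n) :
    largestInformationRatio n ≤ 4 * (n / Real.logb 2 n) := by
  have hn' : (2 : ℝ) ≤ n := by exact_mod_cast hn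
  set L := Real.logb 2 (n : ℝ) with hL
  have hL1 : 1 ≤ L := by
    rw [hL, Real.le_logb_iff_rpow_le one_lt_two (by linarith), Real.rpow_one]
    exact hn'
  -- Then `n / k ≤ 2 * n / L`, while `k - 1 ≤ L / 2` bounds `2 ^ (k - 1)` by `√n`. The remaining `1
  -- + √n` costs another `2 * n / L`, which makes the constant `4`.
  set k := ⌈L / 2⌉₊ with hk
  have hkL : L / 2 ≤ k := Nat.le_ceil _
  have hk0 : 0 < k := Nat.ceil_pos.2 (by linarith)
  refine ciSup_le fun G => (informationRatio_le_of_blocks G hk0).trans ?_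
  have h1 : ((n / k : ℕ) : ℝ) ≤ 2 * (n / L) := by
    calc ((n / k : ℕ) : ℝ) ≤ n / k := Nat.cast_div_le
      _ ≤ n / (L / 2) := by gcongr
      _ = 2 * (n / L) := by field_simp
  have h2 : (2 : ℝ) ^ (k - 1) ≤ √(n : ℝ) := by
    have hk1 : ((k - 1 : ℕ) : ℝ) ≤ L * (1 / 2) := by
      rw [Nat.cast_pred hk0]
      have := Nat.ceil_lt_add_one (a := L / 2) (by linarith)
      linarith
    rw [← Real.rpow_natCast, Real.sqrt_eq_rpow]
    calc (2 : ℝ) ^ ((k - 1 : ℕ) : ℝ) ≤ 2 ^ (L * (1 / 2)) :=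
          Real.rpow_le_rpow_of_exponent_le one_le_two hk1
      _ = (n : ℝ) ^ (1 / 2 : ℝ) := by
          rw [Real.rpow_mul zero_le_two, hL, Real.rpow_logb two_pos (by norm_num) (by linarith)]
  have h3 : 1 + √(n : ℝ) ≤ 2 * (n / L) := by
    rw [← mul_div_assoc, le_div_iff₀ (by linarith)]
    exact one_add_sqrt_mul_logb_le hn
  push_cast
  linarith

end UpperBound

/-! ### Assembly of the two bounds. -/

theorem half_logb_le_informationRatio {V : Type} [Fintype V] {G : SimpleGraph V} {d : ℕ}
    (hd : 2 ≤ d) (φ : cubeGraph d ↪g G) :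
    0.5 * Real.logb 2 ((2 ^ d : ℕ) : ℝ) ≤ informationRatio G := by
  refine le_of_eq_of_le ?_ (half_le_informationRatio_of_cubeGraph_embedding (by omega) φ)
  push_cast
  rw [Real.logb_pow, Real.logb_self_eq_one one_lt_two]
  ring

theorem half_logb_le_largestInformationRatio {d : ℕ} (hd : 2 ≤ d) :
    0.5 * Real.logb 2 ((2 ^ d : ℕ) : ℝ) ≤ largestInformationRatio (2 ^ d) := by
  have e : (Fin d → Bool) ≃ Fin (2 ^ d) := Fintype.equivFinOfCardEq (by simp)
  exact (half_logb_le_informationRatio hd (SimpleGraph.Iso.map e (cubeGraph d)).toEmbedding).trans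
    (le_ciSup (f := fun G : SimpleGraph (Fin (2 ^ d)) => informationRatio G)
      (Set.finite_range _).bddAbove _)

theorem mainTheorem4 :
    -- the upper bound, for all graphs on `n` vertices
    (∀ n : ℕ, 2 ≤ n → largestInformationRatio n ≤ 4 * (n / Real.logb 2 n)) ∧
    -- the lower bound, from the cube, which has `n = 2 ^ d` vertices
    (∀ d : ℕ, 2 ≤ d → 0.5 * Real.logb 2 ((2 ^ d : ℕ) : ℝ) ≤ informationRatio (cubeGraph d)) ∧
    -- the corollary
    {n : ℕ | 0.5 * Real.logb 2 n ≤ largestInformationRatio n ∧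
      largestInformationRatio n ≤ 4 * (n / Real.logb 2 n)}.Infinite := by
  refine ⟨fun n hn => largestInformationRatio_le hn,
    fun d hd => half_logb_le_informationRatio hd (SimpleGraph.Embedding.refl), ?_⟩
  -- The shift by `2` keeps the dimension at least `2`.
  refine Set.infinite_of_injective_forall_mem (f := fun d : ℕ => 2 ^ (d + 2))
    (fun a b h => by simpa using h) fun d => ⟨half_logb_le_largestInformationRatio (by omega),
      largestInformationRatio_le ?_⟩
  exact le_self_pow₀ one_le_two (by omega)
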